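/- Let $\Lambda\in\mathbb R^{N\times N}$, $\Lambda\ne 0$, be a Metzler matrix (all off-diagonal entries are nonnegative) whose complex spectrum $\sigma(\Lambda)$ is contained in $\{z\in\mathbb C:\operatorname{Re} z\le 0\}$ and for which the algebraic and the geometric multiplicity of $0$ both equal $k\ge 0$ (so $k=\dim\ker\Lambda$). Write $\Lambda=S^+-S^-$ with $S^+,S^-\ge 0$ the entrywise positive and negative parts of $\Lambda$ (so $S^-$ is diagonal), and put $\varphi(x)=(1-e^{-x})/x$ for $x>0$, $\varphi(0)=1$. For a step size $\Delta t>0$, the scheme GeCo1 applied to $y'=\Lambda y$ is the iteration $y^{n+1}=g(y^n)$ with $$g(y)=y+\Delta t\,\varphi\Big(\Delta t\sum_{i=1}^N\frac{(S^-y)_i}{y_i}\Big)\Lambda y ,$$ where the quotient $(S^-y)_i/y_i=s^-_{ii}$ is extended continuously to $y_i=0$, so that $g$ is defined on all of $\mathbb R^N$. A fixed point $y^*$ of $g$ is called stable if for every $\varepsilon>0$ there is a $\delta>0$ such that $\|y^0-y^*\|<\delta$ implies $\|y^n-y^*\|<\varepsilon$ for all $n\ge 0$; it is called asymptotically stable if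 in addition there is a $c>0$ such that $\|y^0-y^*\|<c$ implies $\|y^n-y^*\|\to 0$. 1. Let $k>0$ and let $y^*$ be any steady state, i.e. $\Lambda y^*=0$ (in particular any positive one). Then $y^*$ is a stable fixed point of GeCo1 for every $\Delta t>0$. Moreover, there is a $\delta>0$ such that for every $y^0$ with $\|y^0-y^*\|<\delta$ for which $y^*$ is the steady state belonging to the initial value $y^0$, i.e. $n^{\mathsf T}y^0=n^{\mathsf T}y^*$ for all $n\in\ker\Lambda^{\mathsf T}$, the iterates $y^n$ of GeCo1 converge to $y^*$ for every $\Delta t>0$. 2. If $k=0$, then $0$ is an asymptotically stable fixed point of GeCo1 for every $\Delta t>0$. 3. The minimum $M=\min\{2|\operatorname{Re}\lambda|/|\lambda|^2:\lambda\in\sigma(\Lambda)\setminus\{0\}\}$ exists and satisfies $M\operatorname{tr}(S^-)\ge 1$. For every $\Delta t>0$, with $\Phi(\Delta t)=\Delta t\,\varphi(\Delta t\operatorname{tr}(S^-))$, the matrix $I+\Phi(\Delta t)\Lambda$ has the eigenvalue $1$ with algebraic multiplicity exactly $k$ (it is not an eigenvalue if $k=0$), and its other $N-k$ eigenvalues lie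 in the open unit disk. -/

import Mathlib

open Matrix Filter Topology

noncomputable section

/-- The linear system `y' = Λ y` is a positive system with stable steady states and exactly `k`
linear invariants: `Λ ≠ 0` is a Metzler matrix, its complex spectrum lies in the closed left
half-plane, and `0` has algebraic and geometric multiplicity `k`. -/
structure IsStableMetzlerSystem {N : ℕ} (Λ : Matrix (Fin N) (Fin N) ℝ) (k : ℕ) : Prop where
  ne_zero : Λ ≠ 0
  metzler : ∀ i j, i ≠ j → 0 ≤ Λ i j
  spectrum_re_nonpos : ∀ z ∈ spectrum ℂ (Λ.map Complex.ofReal), z.re ≤ 0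
  algebraic_mult : Λ.charpoly.rootMultiplicity 0 = k
  geometric_mult : Module.finrank ℝ (LinearMap.ker Λ.mulVecLin) = k

/-- The production part `S⁺` of `Λ = S⁺ - S⁻`: the entrywise positive part. -/
def productionMatrix {N : ℕ} (Λ : Matrix (Fin N) (Fin N) ℝ) : Matrix (Fin N) (Fin N) ℝ :=
  Λ.map fun a => max a 0

/-- The destruction part `S⁻` of `Λ = S⁺ - S⁻`: the entrywise negative part.
For a Metzler matrix it is diagonal. -/
def destructionMatrix {N : ℕ} (Λ : Matrix (Fin N) (Fin N) ℝ) : Matrix (Fin N) (Fin N) ℝ :=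
  Λ.map fun a => max (-a) 0

/-- The weight function `φ(x) = (1 - e⁻ˣ) / x` for `x > 0`, `φ(0) = 1`
(it is only evaluated at `x ≥ 0`). -/
def gecoPhi (x : ℝ) : ℝ :=
  if 0 < x then (1 - Real.exp (-x)) / x else 1

/-- The relative destruction rate `fᵢᴰ(y) / yᵢ` with `fᴰ(y) = S⁻ y`. For a Metzler matrix
`fᵢᴰ(y) = s⁻ᵢᵢ yᵢ`, so at `yᵢ = 0` the quotient is extended continuously by `s⁻ᵢᵢ`. -/
def relativeDestruction {N : ℕ} (Λ : Matrix (Fin N) (Fin N) ℝ) (y : Fin N → ℝ) (i : Fin N) : ℝ :=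
  if y i = 0 then destructionMatrix Λ i i else (destructionMatrix Λ *ᵥ y) i / y i

/-- The generating map `yⁿ ↦ yⁿ⁺¹` of the first order geometric conservative scheme GeCo1 with
step size `Δt`, applied to `y' = Λ y = S⁺ y - S⁻ y`:
`yⁿ⁺¹ = yⁿ + Δt φ(Δt ∑ᵢ fᵢᴰ(yⁿ) / yᵢⁿ) f(yⁿ)`. -/
def geco1 {N : ℕ} (Λ : Matrix (Fin N) (Fin N) ℝ) (Δt : ℝ) (y : Fin N → ℝ) : Fin N → ℝ :=
  y + (Δt * gecoPhi (Δt * ∑ i, relativeDestruction Λ y i)) •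
    (productionMatrix Λ *ᵥ y - destructionMatrix Λ *ᵥ y)

/-- `ystar` is a (Lyapunov) stable fixed point of the iteration `yⁿ⁺¹ = g(yⁿ)`. -/
def IsLyapunovStableFixedPoint {E : Type*} [NormedAddCommGroup E] (g : E → E) (ystar : E) :
    Prop :=
  g ystar = ystar ∧
    ∀ ε : ℝ, 0 < ε → ∃ δ : ℝ, 0 < δ ∧
      ∀ y₀ : E, ‖y₀ - ystar‖ < δ → ∀ n : ℕ, ‖g^[n] y₀ - ystar‖ < ε

/-- `ystar` is an asymptotically stable fixed point of the iteration `yⁿ⁺¹ = g(yⁿ)`. -/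
def IsAsymptoticallyStableFixedPoint {E : Type*} [NormedAddCommGroup E] (g : E → E)
    (ystar : E) : Prop :=
  IsLyapunovStableFixedPoint g ystar ∧
    ∃ c : ℝ, 0 < c ∧
      ∀ y₀ : E, ‖y₀ - ystar‖ < c → Tendsto (fun n : ℕ => ‖g^[n] y₀ - ystar‖) atTop (𝓝 0)

/-- `y` and `ystar` have the same values of all linear invariants of `y' = Λ y`, that is
`nᵀ y = nᵀ ystar` whenever `nᵀ Λ = 0`. -/
def SameLinearInvariants {N : ℕ} (Λ : Matrix (Fin N) (Fin N) ℝ) (y ystar : Fin N → ℝ) : Prop :=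
  ∀ n : Fin N → ℝ, n ᵥ* Λ = 0 → n ⬝ᵥ y = n ⬝ᵥ ystar

end

/-!
Write `τ = tr S⁻`. As `S⁻` is diagonal, GeCo1 is the linear iteration with matrix `1 + Φ Λ`, where
`Φ = Δt φ(Δt τ)` satisfies `Φ τ < 1`. The matrix `Λ + τ` is nonnegative, so its spectral radius is
an eigenvalue, and since `Λ` has no eigenvalue with positive real part, `σ(Λ)` lies in the disk
`‖z + τ‖ ≤ τ`. This disk is `‖z‖² ≤ 2 |re z| τ`, and `z ↦ 1 + Φ z` maps it, apart from `z = 0`, into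
the open unit disk.

The eigenvalue `0` is semisimple, so there is a `G` commuting with `Λ` such that `Λ G Λ = Λ`, and
`1 - Λ G` is the projection onto `ker Λ` along the range of `Λ`. Hence
`(1 + Φ Λ) ^ m = (1 - Λ G) + (Φ Λ + Λ G) ^ m` for `m ≥ 1`, where the last power tends to `0`. The
limit `1 - Λ G` annihilates `Λ` from the left, so its rows are linear invariants: they carry `y⁰` to
the steady state belonging to it.

The Perron–Frobenius theorem is obtained from the resolvent: an eigenvector `v` of a nonnegative `A`
for an eigenvalue `z` of maximal modulus gives `|v| ≤ (s - ‖z‖) (s - A)⁻¹ |v|` for all `s > ‖z‖`,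
which forces `‖z‖` into the spectrum.
-/

section Spectrum

lemma algebraMap_mem_spectrum_map_iff {n : Type*} [Fintype n] [DecidableEq n]
    {K L : Type*} [Field K] [Field L] [Algebra K L] {A : Matrix n n K} {r : K} :
    algebraMap K L r ∈ spectrum L (A.map (algebraMap K L)) ↔ r ∈ spectrum K A := by
  rw [mem_spectrum_iff_isRoot_charpoly, mem_spectrum_iff_isRoot_charpoly,
    charpoly_map, Polynomial.isRoot_map_iff (algebraMap K L).injective]

lemma exists_mulVec_eq_smul_of_mem_spectrum {n : Type*} [Fintype n] [DecidableEq n]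
    {K : Type*} [Field K] {A : Matrix n n K} {μ : K}
    (hμ : μ ∈ spectrum K A) : ∃ v, v ≠ 0 ∧ A *ᵥ v = μ • v := by
  rw [← spectrum_toLin', ← Module.End.hasEigenvalue_iff_mem_spectrum] at hμ
  obtain ⟨v, hv⟩ := hμ.exists_hasEigenvector
  exact ⟨v, hv.2, by simpa using hv.apply_eq_smul⟩

variable {K R : Type*} [Field K] [Ring R] [Algebra K R]

lemma one_add_mul_mem_spectrum_one_add_smul_iff {a : R} {c z : K} (hc : c ≠ 0) :
    1 + c * z ∈ spectrum K (1 + c • a) ↔ z ∈ spectrum K a := by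
  rw [add_comm 1 (c * z), ← map_one (algebraMap K R), spectrum.add_mem_add_iff]
  exact spectrum.smul_mem_smul_iff (r := Units.mk0 c hc)

end Spectrum

section GroupInverse

section Ring

variable {R : Type*} [Ring R] {a g : R}

lemma one_add_pow_succ_eq_add_pow_succ (hag : Commute a g) (haga : a * g * a = a) (m : ℕ) :
    (1 + a) ^ (m + 1) = (1 - a * g) + (a + a * g) ^ (m + 1) := by
  have hfix : (1 + a) * (1 - a * g) = 1 - a * g := by
    rw [add_mul, one_mul, mul_sub, mul_one, hag.eq, ← mul_assoc, haga, sub_self, add_zero]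
  have hmul : (1 - a * g) * (a + a * g) = 0 := by
    rw [sub_mul, one_mul, mul_add, haga, ← mul_assoc, haga, sub_self]
  induction m with
  | zero => noncomm_ring
  | succ m ih =>
    have hexpand : (1 + a) * (a + a * g) ^ (m + 1) =
        (a + a * g) ^ (m + 2) + (1 - a * g) * (a + a * g) * (a + a * g) ^ m := by
      rw [pow_succ' _ (m + 1), pow_succ' _ m]; noncomm_ring
    rw [pow_succ', ih, mul_add, hfix, hexpand, hmul, zero_mul, add_zero]

lemma eq_zero_of_isNilpotent_of_mul_mul_eq_self (hag : Commute a g) (haga : a * g * a = a)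
    (ha : IsNilpotent a) : a = 0 := by
  obtain ⟨m, hm⟩ := hag.isNilpotent_mul_right ha
  have hpow : ∀ m : ℕ, (a * g) ^ m * a = a := fun m => by
    induction m with
    | zero => simp
    | succ m ih => rw [pow_succ, mul_assoc, haga, ih]
  rw [← hpow m, hm, zero_mul]

end Ring

variable {K R : Type*} [Field K] [Ring R] [Algebra K R] {a g : R}

-- Relative to the complementary idempotents `e` and `1 - e`, both factors are block diagonal.
lemma mul_add_smul_one_sub_mul_eq_one {e u r : R} {z w : K} (he : IsIdempotentElem e)
    (hre : Commute r e) (hure : u * r * e = e) (hzw : z * w = 1) :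
    (u * e + z • (1 - e)) * (r * e + w • (1 - e)) = 1 := by
  have hdiag : u * e * (r * e) = e := by
    rw [mul_assoc, ← mul_assoc e, ← hre.eq, mul_assoc r, he.eq, ← mul_assoc, hure]
  have hupper : u * e * (1 - e) = 0 := by rw [mul_assoc, he.mul_one_sub_self, mul_zero]
  have hlower : (1 - e) * (r * e) = 0 := by
    rw [hre.eq, ← mul_assoc, he.one_sub_mul_self, zero_mul]
  rw [add_mul, mul_add, mul_add, hdiag, mul_smul_comm, hupper, smul_mul_assoc, hlower,
    smul_mul_smul_comm, he.one_sub.eq, hzw, smul_zero, smul_zero, one_smul, add_zero, zero_add,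
    add_sub_cancel]

lemma isUnit_mul_add_smul_one_sub {e u r : R} {z : K} (he : IsIdempotentElem e)
    (hue : Commute u e) (hre : Commute r e) (hur : Commute u r) (hure : u * r * e = e)
    (hz : z ≠ 0) : IsUnit (u * e + z • (1 - e)) :=
  ⟨⟨_, r * e + z⁻¹ • (1 - e),
    mul_add_smul_one_sub_mul_eq_one he hre hure (mul_inv_cancel₀ hz),
    mul_add_smul_one_sub_mul_eq_one he hue (hur.eq ▸ hure) (inv_mul_cancel₀ hz)⟩, rfl⟩

lemma isUnit_algebraMap_sub_add_mul (hag : Commute a g) (haga : a * g * a = a) {z : K}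
    (hz : z ≠ 0) (hz1 : z = 1 ∨ z ∉ spectrum K (1 + a)) :
    IsUnit (algebraMap K R z - (a + a * g)) := by
  set e := a * g with he
  set u := algebraMap K R z - (1 + a) with hu
  have hae : Commute a e := (Commute.refl a).mul_right hag
  have hee : e * e = e := by rw [he, ← mul_assoc, haga]
  have hcomm : Commute u e :=
    (Algebra.commute_algebraMap_left z e).sub_left
      ((Commute.one_left e).add_left hae)
  obtain ⟨r, hur, hre, hinv⟩ : ∃ r, Commute u r ∧ Commute r e ∧ u * r * e = e := by
    rcases hz1 with rfl | hz1
    · have hua : u = -a := by rw [hu, map_one]; abel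
      refine ⟨-g, hua ▸ hag.neg_left.neg_right,
        (hag.symm.mul_right (Commute.refl g)).neg_left, ?_⟩
      rw [hua, neg_mul_neg, ← he, hee]
    · obtain ⟨w, hw⟩ := spectrum.notMem_iff.1 hz1
      rw [← hu] at hw
      rw [← hw] at hcomm ⊢
      exact ⟨↑w⁻¹, by simp, hcomm.units_inv_left, by simp⟩
  have hsplit : algebraMap K R z - (a + e) = u * e + z • (1 - e) := by
    rw [hu, sub_mul, add_mul, one_mul, hae.eq, haga, ← Algebra.smul_def,
      Algebra.algebraMap_eq_smul_one, smul_sub]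
    abel
  rw [hsplit]
  exact isUnit_mul_add_smul_one_sub hee hcomm hre hur hinv hz

lemma spectrum_add_mul_subset (hag : Commute a g) (haga : a * g * a = a) :
    spectrum K (a + a * g) ⊆ insert 0 (spectrum K (1 + a) \ {1}) := by
  intro z hz
  rcases eq_or_ne z 0 with rfl | hz0
  · exact Set.mem_insert _ _
  by_contra hcon
  refine hz (isUnit_algebraMap_sub_add_mul hag haga hz0 ?_)
  simpa [hz0, imp_iff_not_or, or_comm] using hcon

open Polynomial in
lemma exists_commute_mul_mul_eq_self_of_mul_aeval_eq_zero {a : R} {p : K[X]} (hp : p.eval 0 ≠ 0)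
    (ha : a * aeval a p = 0) : ∃ g, Commute a g ∧ a * g * a = a := by
  have hcomm : Commute a (aeval a p.divX) := by
    simpa using (Commute.all X p.divX).map (aeval a)
  have hsplit : a * aeval a p.divX * a = -(p.eval 0 • a) := by
    rw [← divX_mul_X_add p, coeff_zero_eq_eval_zero] at ha
    simp only [map_add, map_mul, aeval_X, aeval_C, mul_add, Algebra.algebraMap_eq_smul_one,
      mul_smul_comm, mul_one, ← mul_assoc] at ha
    exact eq_neg_of_add_eq_zero_left ha
  refine ⟨-(p.eval 0)⁻¹ • aeval a p.divX, hcomm.smul_right _, ?_⟩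
  rw [mul_smul_comm, smul_mul_assoc, hsplit, smul_neg, neg_smul, neg_neg, inv_smul_smul₀ hp]

lemma maxGenEigenspace_eq_eigenspace_of_rootMultiplicity_eq {V : Type*} [AddCommGroup V]
    [Module K V] [FiniteDimensional K V] {f : Module.End K V} {μ : K}
    (hμ : f.charpoly.rootMultiplicity μ = Module.finrank K (f.eigenspace μ)) :
    f.maxGenEigenspace μ = f.eigenspace μ :=
  (Submodule.eq_of_le_of_finrank_eq Module.End.eigenspace_le_maxGenEigenspace
    (by rw [LinearMap.finrank_maxGenEigenspace_eq, hμ])).symm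

open Polynomial in
lemma exists_eval_ne_zero_mul_aeval_eq_zero {V : Type*} [AddCommGroup V] [Module K V]
    [FiniteDimensional K V] {f : Module.End K V}
    (hf : f.charpoly.rootMultiplicity 0 = Module.finrank K (LinearMap.ker f)) :
    ∃ p : K[X], p.eval 0 ≠ 0 ∧ f * aeval f p = 0 := by
  obtain ⟨p, hp, hroot⟩ :=
    exists_eq_pow_rootMultiplicity_mul_and_not_dvd f.charpoly f.charpoly_monic.ne_zero 0
  refine ⟨p, by rwa [dvd_iff_isRoot] at hroot, LinearMap.ext fun v => ?_⟩
  have hmem : aeval f p v ∈ f.maxGenEigenspace 0 := by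
    have hCH := f.aeval_self_charpoly
    rw [hp] at hCH
    simp only [map_zero, sub_zero, map_mul, map_pow, aeval_X] at hCH
    exact (Module.End.mem_maxGenEigenspace _ _ _).2 ⟨_, by simpa using LinearMap.congr_fun hCH v⟩
  rw [maxGenEigenspace_eq_eigenspace_of_rootMultiplicity_eq
    (by rw [hf, Module.End.eigenspace_zero])] at hmem
  simpa using hmem

lemma exists_commute_mul_mul_eq_self_of_rootMultiplicity_eq
    {n : Type*} [Fintype n] [DecidableEq n] {A : Matrix n n K}
    (hA : A.charpoly.rootMultiplicity 0 = Module.finrank K (LinearMap.ker A.mulVecLin)) :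
    ∃ G, Commute A G ∧ A * G * A = A := by
  obtain ⟨p, hp, hzero⟩ := exists_eval_ne_zero_mul_aeval_eq_zero (f := toLinAlgEquiv' A) (by
    rwa [← charpoly_mulVecLin] at hA)
  refine exists_commute_mul_mul_eq_self_of_mul_aeval_eq_zero hp
    ((toLinAlgEquiv' (R := K) (n := n)).injective ?_)
  rw [map_mul, map_zero, ← Polynomial.aeval_algHom_apply, hzero]

lemma rootMultiplicity_charpoly_one_add_smul {n : Type*} [Fintype n] [DecidableEq n]
    (A : Matrix n n K) {c : K} (hc : c ≠ 0) (μ : K) :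
    (1 + c • A).charpoly.rootMultiplicity (1 + c * μ) = A.charpoly.rootMultiplicity μ := by
  have hshift : toLin' (1 + c • A) - (1 + c * μ) • 1 = c • (toLin' A - μ • 1) := by
    rw [map_add, map_smul, toLin'_one, ← Module.End.one_eq_id]
    module
  have heigen : Module.End.maxGenEigenspace (toLin' (1 + c • A)) (1 + c * μ) =
      Module.End.maxGenEigenspace (toLin' A) μ := by
    ext v
    simp only [Module.End.mem_maxGenEigenspace, hshift, smul_pow, LinearMap.smul_apply,
      smul_eq_zero_iff_right (pow_ne_zero _ hc)]
  rw [← charpoly_toLin', ← charpoly_toLin', ← LinearMap.finrank_maxGenEigenspace_eq,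
    ← LinearMap.finrank_maxGenEigenspace_eq, heigen]

lemma isNilpotent_of_spectrum_subset_zero {n : Type*} [Fintype n] [DecidableEq n]
    [IsAlgClosed K] {A : Matrix n n K} (hA : spectrum K A ⊆ {0}) : IsNilpotent A := by
  have hroots : A.charpoly.roots = Multiset.replicate A.charpoly.roots.card 0 :=
    Multiset.eq_replicate.2 ⟨rfl, fun z hz =>
      hA (mem_spectrum_iff_isRoot_charpoly.2 (Polynomial.isRoot_of_mem_roots hz))⟩
  have hcharpoly := (IsAlgClosed.splits A.charpoly).eq_prod_roots_of_monic A.charpoly_monic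
  rw [hroots, Multiset.map_replicate, Multiset.prod_replicate, map_zero, sub_zero] at hcharpoly
  have hCH := A.aeval_self_charpoly
  rw [hcharpoly, map_pow, Polynomial.aeval_X] at hCH
  exact ⟨_, hCH⟩

lemma exists_mem_spectrum_ne_zero {n : Type*} [Fintype n] [DecidableEq n] [IsAlgClosed K]
    {A G : Matrix n n K} (hA : A ≠ 0) (hAG : Commute A G) (hAGA : A * G * A = A) :
    ∃ z ∈ spectrum K A, z ≠ 0 := by
  by_contra! hspec
  exact hA (eq_zero_of_isNilpotent_of_mul_mul_eq_self hAG hAGA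
    (isNilpotent_of_spectrum_subset_zero hspec))

end GroupInverse

section Powers

open scoped ENNReal NNReal in
lemma tendsto_pow_zero_of_forall_norm_lt_one {R : Type*} [NormedRing R] [NormedAlgebra ℂ R]
    [CompleteSpace R] {a : R} (ha : ∀ z ∈ spectrum ℂ a, ‖z‖ < 1) :
    Tendsto (fun m : ℕ => a ^ m) atTop (𝓝 0) := by
  rcases subsingleton_or_nontrivial R with hR | hR
  · exact tendsto_const_nhds.congr fun m => Subsingleton.elim _ _
  have hradius : spectralRadius ℂ a < (1 : ℝ≥0) :=
    spectrum.spectralRadius_lt_of_forall_lt a fun z hz => NNReal.coe_lt_coe.1 (ha z hz)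
  obtain ⟨r, har, hr⟩ := ENNReal.lt_iff_exists_nnreal_btwn.1 hradius
  refine squeeze_zero_norm' ?_
    (tendsto_pow_atTop_nhds_zero_of_lt_one r.coe_nonneg (by exact_mod_cast hr))
  have hgelfand := spectrum.pow_nnnorm_pow_one_div_tendsto_nhds_spectralRadius a
  filter_upwards [hgelfand.eventually_lt_const har, eventually_gt_atTop 0] with m hroot hm
  have hm' : (m : ℝ) ≠ 0 := by exact_mod_cast hm.ne'
  have hpow := ENNReal.rpow_le_rpow hroot.le (Nat.cast_nonneg m)
  rw [← ENNReal.rpow_mul, one_div, inv_mul_cancel₀ hm', ENNReal.rpow_one,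
    ENNReal.rpow_natCast] at hpow
  exact_mod_cast hpow

lemma tendsto_one_add_pow {R : Type*} [NormedRing R] [NormedAlgebra ℂ R] [CompleteSpace R]
    {a g : R} (hag : Commute a g) (haga : a * g * a = a)
    (ha : ∀ z ∈ spectrum ℂ (1 + a), z ≠ 1 → ‖z‖ < 1) :
    Tendsto (fun m : ℕ => (1 + a) ^ m) atTop (𝓝 (1 - a * g)) := by
  have hdecay : Tendsto (fun m : ℕ => (a + a * g) ^ m) atTop (𝓝 0) :=
    tendsto_pow_zero_of_forall_norm_lt_one fun z hz => by
      rcases spectrum_add_mul_subset hag haga hz with rfl | ⟨hz, hz1⟩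
      · simp
      · exact ha z hz hz1
  rw [← tendsto_add_atTop_iff_nat 1]
  simpa only [one_add_pow_succ_eq_add_pow_succ hag haga, add_zero] using
    ((tendsto_add_atTop_iff_nat 1).2 hdecay).const_add (1 - a * g)

variable {n : Type*} [Fintype n] [DecidableEq n]

lemma tendsto_of_tendsto_mapMatrix_ofReal {ι : Type*} {l : Filter ι} {f : ι → Matrix n n ℝ}
    {B : Matrix n n ℝ} (hf : Tendsto (fun i => Complex.ofRealHom.mapMatrix (f i)) l
      (𝓝 (Complex.ofRealHom.mapMatrix B))) : Tendsto f l (𝓝 B) := by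
  have hre : Continuous fun C : Matrix n n ℂ => C.map Complex.re :=
    continuous_id.matrix_map Complex.continuous_re
  simpa [Function.comp_def] using (hre.tendsto _).comp hf

attribute [local instance] Matrix.linftyOpNormedRing Matrix.linftyOpNormedAlgebra in
lemma tendsto_matrix_pow_zero {A : Matrix n n ℝ}
    (hA : ∀ z ∈ spectrum ℂ (A.map Complex.ofReal), ‖z‖ < 1) :
    Tendsto (fun m : ℕ => A ^ m) atTop (𝓝 0) := by
  refine tendsto_of_tendsto_mapMatrix_ofReal ?_
  simp only [map_pow, map_zero]
  exact tendsto_pow_zero_of_forall_norm_lt_one hA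

attribute [local instance] Matrix.linftyOpNormedRing Matrix.linftyOpNormedAlgebra in
lemma tendsto_matrix_one_add_pow {A G : Matrix n n ℝ} (hAG : Commute A G) (hAGA : A * G * A = A)
    (hA : ∀ z ∈ spectrum ℂ ((1 + A).map Complex.ofReal), z ≠ 1 → ‖z‖ < 1) :
    Tendsto (fun m : ℕ => (1 + A) ^ m) atTop (𝓝 (1 - A * G)) := by
  have hmap : (1 + A).map Complex.ofReal = 1 + Complex.ofRealHom.mapMatrix A :=
    (map_add Complex.ofRealHom.mapMatrix 1 A).trans (by rw [map_one])
  refine tendsto_of_tendsto_mapMatrix_ofReal ?_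
  simp only [map_pow, map_add, map_sub, map_mul, map_one]
  exact tendsto_one_add_pow (hAG.map Complex.ofRealHom.mapMatrix)
    (by rw [← map_mul, ← map_mul, hAGA]) (hmap ▸ hA)

end Powers

section PerronFrobenius

variable {n : Type*} [Fintype n] {A : Matrix n n ℝ}

lemma mulVec_mono_of_nonneg (hA : ∀ i j, 0 ≤ A i j) {u v : n → ℝ} (huv : u ≤ v) :
    A *ᵥ u ≤ A *ᵥ v :=
  fun i => dotProduct_le_dotProduct_of_nonneg_left huv (hA i)

lemma norm_smul_norm_le_mulVec_norm (hA : ∀ i j, 0 ≤ A i j) {z : ℂ} {v : n → ℂ}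
    (hv : A.map Complex.ofReal *ᵥ v = z • v) :
    (‖z‖ • fun i => ‖v i‖) ≤ A *ᵥ fun i => ‖v i‖ := fun i => calc
  ‖z‖ * ‖v i‖ = ‖∑ j, (A i j : ℂ) * v j‖ := by
    rw [← norm_mul]
    exact congrArg norm (congrFun hv i).symm
  _ ≤ ∑ j, A i j * ‖v j‖ := (norm_sum_le _ _).trans_eq <| Finset.sum_congr rfl fun j _ => by
    rw [norm_mul, Complex.norm_of_nonneg (hA i j)]

variable [DecidableEq n]

lemma nonneg_of_mulVec_le (hA : ∀ i j, 0 ≤ A i j)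
    (hpow : Tendsto (fun m : ℕ => A ^ m) atTop (𝓝 0)) {u : n → ℝ} (hu : A *ᵥ u ≤ u) : 0 ≤ u := by
  have hle : ∀ m : ℕ, A ^ m *ᵥ u ≤ u := fun m => by
    induction m with
    | zero => simp
    | succ m ih =>
      rw [pow_succ', ← mulVec_mulVec]
      exact (mulVec_mono_of_nonneg hA ih).trans hu
  have hlim : Tendsto (fun m : ℕ => A ^ m *ᵥ u) atTop (𝓝 0) := by
    simpa [Function.comp_def] using
      ((continuous_id.matrix_mulVec continuous_const).tendsto (0 : Matrix n n ℝ)).comp hpow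
  exact le_of_tendsto hlim (Eventually.of_forall hle)

lemma nonneg_of_mulVec_le_smul (hA : ∀ i j, 0 ≤ A i j) {s : ℝ} (hs : 0 < s)
    (hspec : ∀ z ∈ spectrum ℂ (A.map Complex.ofReal), ‖z‖ < s) {u : n → ℝ}
    (hu : A *ᵥ u ≤ s • u) : 0 ≤ u := by
  have hs0 : (s : ℂ) ≠ 0 := by exact_mod_cast hs.ne'
  refine nonneg_of_mulVec_le (A := s⁻¹ • A) (fun i j => mul_nonneg (inv_pos.2 hs).le (hA i j))
    (tendsto_matrix_pow_zero fun z hz => ?_) ?_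
  · have hmap : (s⁻¹ • A).map Complex.ofReal = (s : ℂ)⁻¹ • A.map Complex.ofReal := by ext; simp
    rw [hmap, ← inv_smul_smul₀ hs0 z] at hz
    have hlt := hspec _ ((spectrum.smul_mem_smul_iff (r := (Units.mk0 (s : ℂ) hs0)⁻¹)).1 hz)
    rw [norm_smul, Complex.norm_of_nonneg hs.le] at hlt
    nlinarith
  · rw [smul_mulVec]
    exact (inv_smul_le_iff_of_pos hs).2 hu

lemma le_smul_resolvent_mulVec (hA : ∀ i j, 0 ≤ A i j) {ρ s : ℝ} (hs : 0 < s)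
    (hspec : ∀ z ∈ spectrum ℂ (A.map Complex.ofReal), ‖z‖ < s) {w : n → ℝ}
    (hw : ρ • w ≤ A *ᵥ w) : w ≤ (s - ρ) • (resolvent A s *ᵥ w) := by
  have hs' : s ∈ resolventSet ℝ A := by
    by_contra hmem
    have := hspec _ (algebraMap_mem_spectrum_map_iff.2 hmem)
    simp [abs_of_pos hs] at this
  have hres : A *ᵥ (resolvent A s *ᵥ w) = s • (resolvent A s *ᵥ w) - w := by
    have hinv : (algebraMap ℝ _ s - A) * resolvent A s = 1 := Ring.mul_inverse_cancel _ hs'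
    rw [sub_mul, Algebra.algebraMap_eq_smul_one, smul_mul_assoc, one_mul, sub_eq_iff_eq_add,
      ← sub_eq_iff_eq_add'] at hinv
    rw [mulVec_mulVec, ← hinv, sub_mulVec, smul_mulVec, one_mulVec]
  refine sub_nonneg.1 (nonneg_of_mulVec_le_smul hA hs hspec ?_)
  rw [mulVec_sub, mulVec_smul, hres, ← sub_nonneg]
  convert sub_nonneg.2 hw using 1
  module

attribute [local instance] Matrix.linftyOpNormedRing Matrix.linftyOpNormedAlgebra in
lemma norm_mem_spectrum_of_forall_norm_le (hA : ∀ i j, 0 ≤ A i j) {z : ℂ}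
    (hz : z ∈ spectrum ℂ (A.map Complex.ofReal))
    (hmax : ∀ z' ∈ spectrum ℂ (A.map Complex.ofReal), ‖z'‖ ≤ ‖z‖) : ‖z‖ ∈ spectrum ℝ A := by
  by_contra hρ
  obtain ⟨v, hv0, hv⟩ := exists_mulVec_eq_smul_of_mem_spectrum hz
  set w : n → ℝ := fun i => ‖v i‖
  have hle : ∀ s > ‖z‖, w ≤ (s - ‖z‖) • (resolvent A s *ᵥ w) := fun s hs =>
    le_smul_resolvent_mulVec hA ((norm_nonneg z).trans_lt hs)
      (fun z' hz' => (hmax z' hz').trans_lt hs) (norm_smul_norm_le_mulVec_norm hA hv)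
  have hcont : ContinuousAt (fun s : ℝ => resolvent A s) ‖z‖ :=
    (spectrum.hasDerivAt_resolvent_const_left (not_not.1 hρ)).continuousAt
  have hlim : Tendsto (fun s : ℝ => (s - ‖z‖) • (resolvent A s *ᵥ w)) (𝓝[>] ‖z‖) (𝓝 0) := by
    have hmulVec : Continuous fun B : Matrix n n ℝ => B *ᵥ w :=
      continuous_id.matrix_mulVec continuous_const
    have hlim' := (continuousAt_id.sub_const ‖z‖).smul (hmulVec.continuousAt.comp hcont)
    simpa using Tendsto.mono_left hlim' nhdsWithin_le_nhds
  have hw : w ≤ 0 := ge_of_tendsto hlim (eventually_mem_nhdsWithin.mono hle)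
  exact hv0 (funext fun i => norm_le_zero_iff.1 (hw i))

lemma exists_mem_spectrum_norm_le (hA : ∀ i j, 0 ≤ A i j) {z : ℂ}
    (hz : z ∈ spectrum ℂ (A.map Complex.ofReal)) : ∃ r ∈ spectrum ℝ A, ‖z‖ ≤ r := by
  obtain ⟨z₀, hz₀, hmax⟩ := Set.exists_max_image _ norm (Matrix.finite_spectrum _) ⟨z, hz⟩
  exact ⟨_, norm_mem_spectrum_of_forall_norm_le hA hz₀ hmax, hmax z hz⟩

end PerronFrobenius

section Metzler

lemma norm_sq_le_of_norm_add_le {z : ℂ} {τ : ℝ} (hz : ‖z + τ‖ ≤ τ) :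
    ‖z‖ ^ 2 ≤ 2 * |z.re| * τ := by
  have hτ : 0 ≤ τ := (norm_nonneg _).trans hz
  have hsq : ‖z + τ‖ ^ 2 ≤ τ ^ 2 := by gcongr
  rw [Complex.sq_norm, Complex.normSq_apply] at hsq ⊢
  simp only [Complex.add_re, Complex.add_im, Complex.ofReal_re, Complex.ofReal_im] at hsq
  nlinarith [mul_le_mul_of_nonneg_right (neg_abs_le z.re) hτ]

lemma re_neg_of_norm_add_le {z : ℂ} {τ : ℝ} (hz0 : z ≠ 0) (hz : ‖z + τ‖ ≤ τ) : z.re < 0 := by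
  have hre : z.re + τ ≤ τ := by simpa using (Complex.re_le_norm (z + τ)).trans hz
  refine lt_of_le_of_ne (by linarith) fun h0 => hz0 ?_
  have hsq : ‖z‖ ^ 2 ≤ 0 := by simpa [h0] using norm_sq_le_of_norm_add_le hz
  exact norm_eq_zero.1 (pow_eq_zero_iff two_ne_zero |>.1 (hsq.antisymm (sq_nonneg _)))

lemma norm_one_add_mul_lt_one {z : ℂ} {τ Φ : ℝ} (hz0 : z ≠ 0) (hz : ‖z + τ‖ ≤ τ) (hΦ : 0 < Φ)
    (hΦτ : Φ * τ < 1) : ‖1 + Φ * z‖ < 1 := by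
  have hre := re_neg_of_norm_add_le hz0 hz
  have hsq := norm_sq_le_of_norm_add_le hz
  rw [abs_of_neg hre] at hsq
  have hexpand : ‖1 + Φ * z‖ ^ 2 = 1 + Φ * (2 * z.re + Φ * ‖z‖ ^ 2) := by
    simp only [Complex.sq_norm, Complex.normSq_apply, Complex.add_re, Complex.add_im,
      Complex.one_re, Complex.one_im, Complex.re_ofReal_mul, Complex.im_ofReal_mul]
    ring
  have hdecrease : 2 * z.re + Φ * ‖z‖ ^ 2 < 0 := by
    nlinarith [mul_le_mul_of_nonneg_left hsq hΦ.le]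
  rw [← sq_lt_one_iff₀ (norm_nonneg _), hexpand]
  linarith [mul_neg_of_pos_of_neg hΦ hdecrease]

variable {n : Type*} [Fintype n] [DecidableEq n]

lemma exists_mem_spectrum_norm_add_le_of_metzler {A : Matrix n n ℝ}
    (hA : ∀ i j, i ≠ j → 0 ≤ A i j) {τ : ℝ} (hτ : ∀ i, -A i i ≤ τ) {z : ℂ}
    (hz : z ∈ spectrum ℂ (A.map Complex.ofReal)) :
    ∃ r ∈ spectrum ℝ A, ‖z + τ‖ ≤ r + τ := by
  have hnonneg : ∀ i j, 0 ≤ (algebraMap ℝ (Matrix n n ℝ) τ + A) i j := fun i j => by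
    rcases eq_or_ne i j with rfl | hij
    · simpa [algebraMap_matrix_apply] using neg_le_iff_add_nonneg.1 (hτ i)
    · simpa [algebraMap_matrix_apply, hij] using hA i j hij
  have hmap : (algebraMap ℝ (Matrix n n ℝ) τ + A).map Complex.ofReal =
      algebraMap ℂ (Matrix n n ℂ) τ + A.map Complex.ofReal := by
    ext i j
    rcases eq_or_ne i j with rfl | hij <;> simp [algebraMap_matrix_apply, *]
  obtain ⟨r, hr, hzr⟩ := exists_mem_spectrum_norm_le hnonneg
    (hmap ▸ spectrum.add_mem_add_iff.2 hz)
  rw [← sub_add_cancel r τ] at hr hzr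
  exact ⟨r - τ, spectrum.add_mem_add_iff.1 hr, hzr⟩

lemma norm_add_le_of_metzler {A : Matrix n n ℝ} (hA : ∀ i j, i ≠ j → 0 ≤ A i j)
    (hspec : ∀ z ∈ spectrum ℂ (A.map Complex.ofReal), z.re ≤ 0) {τ : ℝ} (hτ : ∀ i, -A i i ≤ τ)
    {z : ℂ} (hz : z ∈ spectrum ℂ (A.map Complex.ofReal)) : ‖z + τ‖ ≤ τ := by
  obtain ⟨r, hr, hzr⟩ := exists_mem_spectrum_norm_add_le_of_metzler hA hτ hz
  have hr0 : r ≤ 0 := by simpa using hspec r (algebraMap_mem_spectrum_map_iff.2 hr)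
  linarith

end Metzler

section LinearIteration

variable {n : Type*} [Fintype n] [DecidableEq n] {J Q : Matrix n n ℝ}

lemma iterate_mulVec (J : Matrix n n ℝ) (m : ℕ) (y : n → ℝ) :
    (J *ᵥ ·)^[m] y = J ^ m *ᵥ y := by
  induction m with
  | zero => simp
  | succ m ih => rw [Function.iterate_succ_apply', ih, mulVec_mulVec, pow_succ']

lemma tendsto_iterate_mulVec (hJ : Tendsto (fun m : ℕ => J ^ m) atTop (𝓝 Q)) (y : n → ℝ) :
    Tendsto (fun m : ℕ => (J *ᵥ ·)^[m] y) atTop (𝓝 (Q *ᵥ y)) := by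
  simp only [iterate_mulVec]
  exact ((continuous_id.matrix_mulVec continuous_const).tendsto Q).comp hJ

attribute [local instance] Matrix.linftyOpNormedRing in
lemma isLyapunovStableFixedPoint_mulVec (hJ : Tendsto (fun m : ℕ => J ^ m) atTop (𝓝 Q))
    {y : n → ℝ} (hy : J *ᵥ y = y) : IsLyapunovStableFixedPoint (J *ᵥ ·) y := by
  obtain ⟨C, hC0, hC⟩ := (Metric.isBounded_range_of_tendsto _ hJ).exists_pos_norm_le
  refine ⟨hy, fun ε hε => ⟨ε / C, div_pos hε hC0, fun y₀ hy₀ m => ?_⟩⟩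
  calc ‖(J *ᵥ ·)^[m] y₀ - y‖ = ‖J ^ m *ᵥ (y₀ - y)‖ := by
        rw [mulVec_sub, ← iterate_mulVec, ← iterate_mulVec, Function.iterate_fixed hy]
    _ ≤ ‖J ^ m‖ * ‖y₀ - y‖ := linfty_opNorm_mulVec _ _
    _ ≤ C * ‖y₀ - y‖ := by gcongr; exact hC _ ⟨m, rfl⟩
    _ < ε := (lt_div_iff₀' hC0).1 hy₀

end LinearIteration

section LinearInvariants

variable {N : ℕ} {Λ : Matrix (Fin N) (Fin N) ℝ}

lemma SameLinearInvariants.mulVec_eq {y ystar : Fin N → ℝ} (h : SameLinearInvariants Λ y ystar)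
    {Q : Matrix (Fin N) (Fin N) ℝ} (hQ : Q * Λ = 0) : Q *ᵥ y = Q *ᵥ ystar :=
  funext fun i => h (Q i) (congrFun hQ i)

lemma sameLinearInvariants_of_isUnit (hΛ : IsUnit Λ) (y ystar : Fin N → ℝ) :
    SameLinearInvariants Λ y ystar := fun n hn => by
  rw [vecMul_injective_of_isUnit hΛ (hn.trans (zero_vecMul Λ).symm), zero_dotProduct,
    zero_dotProduct]

end LinearInvariants

section GeCo1

lemma gecoPhi_pos (x : ℝ) : 0 < gecoPhi x := by
  rw [gecoPhi]
  split_ifs with hx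
  · exact div_pos (sub_pos.2 (Real.exp_lt_one_iff.2 (neg_neg_of_pos hx))) hx
  · exact one_pos

lemma gecoPhi_mul_self_lt_one (x : ℝ) : gecoPhi x * x < 1 := by
  rw [gecoPhi]
  split_ifs with hx
  · rw [div_mul_cancel₀ _ hx.ne']
    exact sub_lt_self 1 (Real.exp_pos _)
  · linarith

variable {N : ℕ} {Λ : Matrix (Fin N) (Fin N) ℝ}

/-- The effective step size `Φ(Δt) = Δt φ(Δt tr S⁻)` with which GeCo1 acts as an explicit Euler
step on `y' = Λ y`. -/
noncomputable def gecoStep (Λ : Matrix (Fin N) (Fin N) ℝ) (Δt : ℝ) : ℝ :=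
  Δt * gecoPhi (Δt * (destructionMatrix Λ).trace)

lemma gecoStep_pos (Λ : Matrix (Fin N) (Fin N) ℝ) {Δt : ℝ} (hΔt : 0 < Δt) :
    0 < gecoStep Λ Δt :=
  mul_pos hΔt (gecoPhi_pos _)

lemma gecoStep_mul_trace_lt_one (Λ : Matrix (Fin N) (Fin N) ℝ) (Δt : ℝ) :
    gecoStep Λ Δt * (destructionMatrix Λ).trace < 1 := by
  rw [gecoStep, mul_right_comm, mul_comm]
  exact gecoPhi_mul_self_lt_one _

lemma productionMatrix_sub_destructionMatrix (Λ : Matrix (Fin N) (Fin N) ℝ) :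
    productionMatrix Λ - destructionMatrix Λ = Λ := by
  ext i j
  exact posPart_sub_negPart (Λ i j)

lemma neg_apply_self_le_trace_destructionMatrix (Λ : Matrix (Fin N) (Fin N) ℝ) (i : Fin N) :
    -Λ i i ≤ (destructionMatrix Λ).trace :=
  (le_max_left _ _).trans <| Finset.single_le_sum (f := fun i => destructionMatrix Λ i i)
    (fun _ _ => le_max_right _ _) (Finset.mem_univ i)

lemma relativeDestruction_eq (hΛ : ∀ i j, i ≠ j → 0 ≤ Λ i j) (y : Fin N → ℝ) (i : Fin N) :
    relativeDestruction Λ y i = destructionMatrix Λ i i := by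
  have hdiag : ∀ j, j ≠ i → destructionMatrix Λ i j = 0 := fun j hj =>
    max_eq_right (neg_nonpos.2 (hΛ i j hj.symm))
  have hmulVec : (destructionMatrix Λ *ᵥ y) i = destructionMatrix Λ i i * y i :=
    Fintype.sum_eq_single i fun j hj => mul_eq_zero_of_left (hdiag j hj) _
  rw [relativeDestruction, hmulVec]
  split_ifs with hy
  · rfl
  · exact mul_div_cancel_right₀ _ hy

lemma geco1_eq_mulVec (hΛ : ∀ i j, i ≠ j → 0 ≤ Λ i j) (Δt : ℝ) :
    geco1 Λ Δt = ((1 + gecoStep Λ Δt • Λ) *ᵥ ·) := by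
  ext1 y
  simp only [geco1, relativeDestruction_eq hΛ, ← sub_mulVec,
    productionMatrix_sub_destructionMatrix, add_mulVec, one_mulVec, smul_mulVec]
  rfl

end GeCo1

namespace IsStableMetzlerSystem

variable {N : ℕ} {Λ : Matrix (Fin N) (Fin N) ℝ} {k : ℕ}

lemma norm_add_trace_le (h : IsStableMetzlerSystem Λ k) {z : ℂ}
    (hz : z ∈ spectrum ℂ (Λ.map Complex.ofReal)) :
    ‖z + (destructionMatrix Λ).trace‖ ≤ (destructionMatrix Λ).trace :=
  norm_add_le_of_metzler h.metzler h.spectrum_re_nonpos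
    (neg_apply_self_le_trace_destructionMatrix Λ) hz

lemma exists_commute_mul_mul_eq_self (h : IsStableMetzlerSystem Λ k) :
    ∃ G, Commute Λ G ∧ Λ * G * Λ = Λ :=
  exists_commute_mul_mul_eq_self_of_rootMultiplicity_eq
    (h.algebraic_mult.trans h.geometric_mult.symm)

lemma spectrum_diff_zero_nonempty (h : IsStableMetzlerSystem Λ k) :
    (spectrum ℂ (Λ.map Complex.ofReal) \ {0}).Nonempty := by
  obtain ⟨G, hΛG, hΛGΛ⟩ := h.exists_commute_mul_mul_eq_self
  have hne : Complex.ofRealHom.mapMatrix Λ ≠ 0 := fun h0 => h.ne_zero <|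
    Matrix.map_injective Complex.ofReal_injective
      (h0.trans (map_zero Complex.ofRealHom.mapMatrix).symm)
  have hmap : Complex.ofRealHom.mapMatrix Λ * Complex.ofRealHom.mapMatrix G *
      Complex.ofRealHom.mapMatrix Λ = Complex.ofRealHom.mapMatrix Λ := by
    rw [← map_mul, ← map_mul, hΛGΛ]
  exact exists_mem_spectrum_ne_zero hne (hΛG.map Complex.ofRealHom.mapMatrix) hmap

lemma exists_isLeast (h : IsStableMetzlerSystem Λ k) :
    ∃ M : ℝ, IsLeast {m : ℝ | ∃ z ∈ spectrum ℂ (Λ.map Complex.ofReal), z ≠ 0 ∧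
      m = 2 * |z.re| / ‖z‖ ^ 2} M ∧ 1 ≤ M * (destructionMatrix Λ).trace := by
  obtain ⟨z, ⟨hz, hz0⟩, hmin⟩ := Set.exists_min_image _ (fun z : ℂ => 2 * |z.re| / ‖z‖ ^ 2)
    (Matrix.finite_spectrum _).sdiff h.spectrum_diff_zero_nonempty
  refine ⟨_, ⟨⟨z, hz, hz0, rfl⟩, ?_⟩, ?_⟩
  · rintro _ ⟨z', hz', hz'0, rfl⟩
    exact hmin z' ⟨hz', hz'0⟩
  · rw [div_mul_eq_mul_div, one_le_div (pow_pos (norm_pos_iff.2 hz0) 2)]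
    exact norm_sq_le_of_norm_add_le (h.norm_add_trace_le hz)

lemma norm_lt_one_of_mem_spectrum_one_add_smul (h : IsStableMetzlerSystem Λ k) {Φ : ℝ}
    (hΦ : 0 < Φ) (hΦτ : Φ * (destructionMatrix Λ).trace < 1) {z : ℂ}
    (hz : z ∈ spectrum ℂ ((1 + Φ • Λ).map Complex.ofReal)) (hz1 : z ≠ 1) : ‖z‖ < 1 := by
  have hΦ0 : (Φ : ℂ) ≠ 0 := by exact_mod_cast hΦ.ne'
  have hmap : (1 + Φ • Λ).map Complex.ofReal = 1 + (Φ : ℂ) • Λ.map Complex.ofReal := by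
    ext i j
    rcases eq_or_ne i j with rfl | hij <;> simp [*]
  obtain ⟨w, rfl⟩ : ∃ w, 1 + Φ * w = z := ⟨(z - 1) / Φ, by field_simp; ring⟩
  rw [hmap, one_add_mul_mem_spectrum_one_add_smul_iff hΦ0] at hz
  exact norm_one_add_mul_lt_one (by rintro rfl; simp at hz1) (h.norm_add_trace_le hz) hΦ hΦτ

lemma rootMultiplicity_one_charpoly_one_add_smul (h : IsStableMetzlerSystem Λ k) {Φ : ℝ}
    (hΦ : Φ ≠ 0) : (1 + Φ • Λ).charpoly.rootMultiplicity 1 = k := by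
  simpa [h.algebraic_mult] using rootMultiplicity_charpoly_one_add_smul Λ hΦ 0

lemma exists_tendsto_pow_one_add_smul (h : IsStableMetzlerSystem Λ k) {Φ : ℝ} (hΦ : 0 < Φ)
    (hΦτ : Φ * (destructionMatrix Λ).trace < 1) :
    ∃ Q, Q * Λ = 0 ∧ Tendsto (fun m : ℕ => (1 + Φ • Λ) ^ m) atTop (𝓝 Q) := by
  obtain ⟨G, hΛG, hΛGΛ⟩ := h.exists_commute_mul_mul_eq_self
  have hcancel : Φ • Λ * Φ⁻¹ • G = Λ * G := by
    rw [smul_mul_smul_comm, mul_inv_cancel₀ hΦ.ne', one_smul]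
  refine ⟨1 - Λ * G, by rw [sub_mul, one_mul, hΛGΛ, sub_self], ?_⟩
  rw [← hcancel]
  exact tendsto_matrix_one_add_pow ((hΛG.smul_left Φ).smul_right Φ⁻¹)
    (by rw [hcancel, mul_smul_comm, hΛGΛ])
    fun z hz hz1 => h.norm_lt_one_of_mem_spectrum_one_add_smul hΦ hΦτ hz hz1

lemma isUnit_of_eq_zero (h : IsStableMetzlerSystem Λ 0) : IsUnit Λ := by
  rw [← mulVec_injective_iff_isUnit]
  exact LinearMap.ker_eq_bot.1 (Submodule.finrank_eq_zero.1 h.geometric_mult)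

lemma isLyapunovStableFixedPoint_geco1 (h : IsStableMetzlerSystem Λ k) {ystar : Fin N → ℝ}
    (hystar : Λ *ᵥ ystar = 0) {Δt : ℝ} (hΔt : 0 < Δt) :
    IsLyapunovStableFixedPoint (geco1 Λ Δt) ystar := by
  obtain ⟨Q, -, hQ⟩ := h.exists_tendsto_pow_one_add_smul (gecoStep_pos Λ hΔt)
    (gecoStep_mul_trace_lt_one Λ Δt)
  rw [geco1_eq_mulVec h.metzler]
  exact isLyapunovStableFixedPoint_mulVec hQ
    (by rw [add_mulVec, one_mulVec, smul_mulVec, hystar, smul_zero, add_zero])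

lemma tendsto_geco1_iterate (h : IsStableMetzlerSystem Λ k) {ystar y₀ : Fin N → ℝ}
    (hystar : Λ *ᵥ ystar = 0) (hy₀ : SameLinearInvariants Λ y₀ ystar) {Δt : ℝ} (hΔt : 0 < Δt) :
    Tendsto (fun m : ℕ => (geco1 Λ Δt)^[m] y₀) atTop (𝓝 ystar) := by
  obtain ⟨Q, hQΛ, hQ⟩ := h.exists_tendsto_pow_one_add_smul (gecoStep_pos Λ hΔt)
    (gecoStep_mul_trace_lt_one Λ Δt)
  have hfix : (geco1 Λ Δt) ystar = ystar := (h.isLyapunovStableFixedPoint_geco1 hystar hΔt).1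
  rw [geco1_eq_mulVec h.metzler] at hfix ⊢
  have hlim : Q *ᵥ ystar = ystar := tendsto_nhds_unique (tendsto_iterate_mulVec hQ ystar) <| by
    simp only [Function.iterate_fixed hfix, tendsto_const_nhds]
  rw [← hlim, ← hy₀.mulVec_eq hQΛ]
  exact tendsto_iterate_mulVec hQ y₀

end IsStableMetzlerSystem

theorem mainTheorem10_general {N : ℕ} (Λ : Matrix (Fin N) (Fin N) ℝ) (k : ℕ)
    (hΛ : IsStableMetzlerSystem Λ k) :
    (∀ ystar : Fin N → ℝ, Λ *ᵥ ystar = 0 → ∀ Δt : ℝ, 0 < Δt →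
      IsLyapunovStableFixedPoint (geco1 Λ Δt) ystar ∧
      ∀ y₀ : Fin N → ℝ, SameLinearInvariants Λ y₀ ystar →
        Tendsto (fun n : ℕ => (geco1 Λ Δt)^[n] y₀) atTop (𝓝 ystar)) ∧
    (k = 0 → ∀ Δt : ℝ, 0 < Δt → ∀ y₀ : Fin N → ℝ,
      Tendsto (fun n : ℕ => (geco1 Λ Δt)^[n] y₀) atTop (𝓝 0)) ∧
    (∃ M : ℝ,
      IsLeast {m : ℝ | ∃ z ∈ spectrum ℂ (Λ.map Complex.ofReal), z ≠ 0 ∧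
        m = 2 * |z.re| / ‖z‖ ^ 2} M ∧
      1 ≤ M * (destructionMatrix Λ).trace) ∧
    (∀ Δt : ℝ, 0 < Δt →
      (1 + gecoStep Λ Δt • Λ).charpoly.rootMultiplicity 1 = k ∧
      ∀ z ∈ spectrum ℂ ((1 + gecoStep Λ Δt • Λ).map Complex.ofReal), z ≠ 1 → ‖z‖ < 1) := by
  refine ⟨fun ystar hystar Δt hΔt => ⟨hΛ.isLyapunovStableFixedPoint_geco1 hystar hΔt,
    fun y₀ hy₀ => hΛ.tendsto_geco1_iterate hystar hy₀ hΔt⟩, ?_, hΛ.exists_isLeast,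
    fun Δt hΔt => ⟨hΛ.rootMultiplicity_one_charpoly_one_add_smul (gecoStep_pos Λ hΔt).ne',
      fun z => hΛ.norm_lt_one_of_mem_spectrum_one_add_smul (gecoStep_pos Λ hΔt)
        (gecoStep_mul_trace_lt_one Λ Δt)⟩⟩
  rintro rfl Δt hΔt y₀
  exact hΛ.tendsto_geco1_iterate (mulVec_zero Λ)
    (sameLinearInvariants_of_isUnit hΛ.isUnit_of_eq_zero y₀ 0) hΔt

theorem mainTheorem10 {N : ℕ} (Λ : Matrix (Fin N) (Fin N) ℝ) (k : ℕ)
    (hΛ : IsStableMetzlerSystem Λ k) :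
    (0 < k → ∀ ystar : Fin N → ℝ, Λ *ᵥ ystar = 0 →
      (∀ Δt : ℝ, 0 < Δt → IsLyapunovStableFixedPoint (geco1 Λ Δt) ystar) ∧
      ∃ δ : ℝ, 0 < δ ∧ ∀ y₀ : Fin N → ℝ, SameLinearInvariants Λ y₀ ystar → ‖y₀ - ystar‖ < δ →
        ∀ Δt : ℝ, 0 < Δt → Tendsto (fun n : ℕ => (geco1 Λ Δt)^[n] y₀) atTop (𝓝 ystar)) ∧
    (k = 0 → ∀ Δt : ℝ, 0 < Δt →
      IsAsymptoticallyStableFixedPoint (geco1 Λ Δt) (0 : Fin N → ℝ)) ∧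
    (∃ M : ℝ,
      IsLeast {m : ℝ | ∃ z ∈ spectrum ℂ (Λ.map Complex.ofReal), z ≠ 0 ∧
        m = 2 * |z.re| / ‖z‖ ^ 2} M ∧
      1 ≤ M * (destructionMatrix Λ).trace) ∧
    (∀ Δt : ℝ, 0 < Δt → ∀ J : Matrix (Fin N) (Fin N) ℝ,
      J = 1 + (Δt * gecoPhi (Δt * (destructionMatrix Λ).trace)) • Λ →
      J.charpoly.rootMultiplicity 1 = k ∧
      ∀ z ∈ spectrum ℂ (J.map Complex.ofReal), z ≠ 1 → ‖z‖ < 1) := by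
  obtain ⟨hsteady, hzero, hM, hJ⟩ := mainTheorem10_general Λ k hΛ
  exact ⟨fun _ ystar hystar => ⟨fun Δt hΔt => (hsteady ystar hystar Δt hΔt).1, 1, one_pos,
      fun y₀ hy₀ _ Δt hΔt => (hsteady ystar hystar Δt hΔt).2 y₀ hy₀⟩,
    fun hk Δt hΔt => ⟨(hsteady 0 (mulVec_zero Λ) Δt hΔt).1, 1, one_pos,
      fun y₀ _ => tendsto_iff_norm_sub_tendsto_zero.1 (hzero hk Δt hΔt y₀)⟩,
    hM, by rintro Δt hΔt _ rfl; exact hJ Δt hΔt⟩
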